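/- Let $F$ be a field and let $\mathcal{P}_n$ be the set of monic $f\in F[x]$ of degree $n$ with $f(0)=0$. An ordered factorization of $n\ge 1$ is a finite sequence $\mathbf{d}=(d_1,\dots,d_\ell)$ of integers $d_i\ge 2$ with product $n$. Two ordered factorizations $\mathbf{d},\mathbf{e}$ of $n$ are *associated* if they have the same length and there is a permutation $\sigma$ of the positions with $d_i=e_{\sigma(i)}$ for all $i$ and $\sigma(i)<\sigma(j)$ whenever $i<j$ and $\gcd(d_i,d_j)>1$. Let $\mathbf{D}$ be a nonempty finite set of pairwise associated ordered factorizations of $n$. The *relation graph* $G$ of $\mathbf{D}$ is the directed graph whose vertices are the elements of the common underlying multiset of the $\mathbf{d}\in\mathbf{D}$ (repeated factors are distinguished: the $k$-th occurrence of a value in one sequence is identified with its $k$-th occurrence in any other), with an edge $u\leftarrow v$ whenever $u$ occurs before $v$ in some $\mathbf{d}\in\mathbf{D}$. For a finite directed graph $H$ whose vertices are such (labelled) integers, a *transitive Hamiltonian path* is an enumeration $e_1,\dots,e_m$ of all vertices of $H$, each exactly once, such that $e_i\leftarrow e_j$ is an edge of $H$ for all $i<j$. Let $\mathcal{D}_H$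 be the set of all $f\in\mathcal{P}_N$, where $N$ is the product of all vertices of $H$, such that for every transitive Hamiltonian path $e_1\leftarrow\dots\leftarrow e_m$ in $H$ there are $g_i\in\mathcal{P}_{e_i}$ with $f=g_1\circ\dots\circ g_m$. **Theorem 3.14.** Let $G$ be a relation graph of a set of ordered factorizations of $n$ as above, where $n$ is not divisible by the characteristic of $F$. The strongly connected components of $G$ (as induced subgraphs) can be listed, each exactly once, as a chain $G_1\leftarrow G_2\leftarrow\dots\leftarrow G_\ell$, meaning that for each $i<\ell$ there is an edge of $G$ from a vertex of $G_{i+1}$ to a vertex of $G_i$. For every such listing, $$\mathcal{D}_G=\mathcal{D}_{G_1}\circ\mathcal{D}_{G_2}\circ\dots\circ\mathcal{D}_{G_\ell}=\{g_1\circ\dots\circ g_\ell : g_i\in\mathcal{D}_{G_i}\},$$ and for every $f\in\mathcal{D}_G$ there are uniquely determined $g_i\in\mathcal{D}_{G_i}$, $1\le i\le\ell$, such that $f=g_1\circ g_2\circ\dots\circ g_\ell$. Furthermore, if $F=\mathbb{F}_q$ is a finite field, then all these sets are finite and $$\#\mathcal{D}_G=\prod_{1\le i\le\ell}\#\mathcal{D}_{G_i}.$$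 (For $n=1$ the graph is empty, $\ell=0$, and the empty composition is $x$.) -/

import Mathlib

open Polynomial

namespace TameCollision

/-! ### Ordered factorizations -/

/-- `d` is an ordered factorization of `n`: a finite sequence of integers `≥ 2` with product `n`.
(The one-term factorization `(n)` is allowed; the empty one occurs only for `n = 1`.) -/
def IsOrderedFactorization (n : ℕ) (d : List ℕ) : Prop :=
  d.prod = n ∧ ∀ a ∈ d, 2 ≤ a

/-- Two sequences are associated: they have the same entries up to a permutation `σ` of the
positions, `d_i = e_{σ(i)}`, with `σ(i) < σ(j)` whenever `i < j` and `gcd (d_i, d_j) > 1`. -/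
def AreAssociated (d e : List ℕ) : Prop :=
  ∃ σ : Fin d.length ≃ Fin e.length,
    (∀ i, d.get i = e.get (σ i)) ∧
      ∀ i j, i < j → 1 < Nat.gcd (d.get i) (d.get j) → σ i < σ j

/-- A normalized set of ordered factorizations of `n`: a nonempty finite set of ordered
factorizations of `n` which are pairwise associated. -/
structure IsNormalized (n : ℕ) (D : Finset (List ℕ)) : Prop where
  nonempty : D.Nonempty
  factorization : ∀ d ∈ D, IsOrderedFactorization n d
  associated : ∀ d ∈ D, ∀ e ∈ D, AreAssociated d e

/-! ### Relation graphs -/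

/-- Elements of a multiset of positive integers, with repeated elements distinguished: the pair
`(a, k)` is the copy number `k` (counted from `0`) of the integer `a`. -/
abbrev Vertex : Type := ℕ × ℕ

/-- The integer that a vertex is a copy of. -/
def Vertex.value (v : Vertex) : ℕ := v.1

/-- The entry of `d` at position `i`, as an element of the basis (the underlying multiset) of `d`:
its value, with the number of earlier entries of the same value. -/
def vertexAt (d : List ℕ) (i : Fin d.length) : Vertex :=
  (d.get i, (d.take i).count (d.get i))

/-- A finite directed graph whose vertices are elements of a multiset of integers.
`G.Adj x y` means that there is an edge from `x` to `y`, also written `y ← x`. -/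
structure FactorGraph extends Digraph Vertex where
  /-- the vertex set -/
  verts : Finset Vertex
  adj_left : ∀ x y, Adj x y → x ∈ verts
  adj_right : ∀ x y, Adj x y → y ∈ verts

/-- The relation graph of a set `D` of ordered factorizations: the union over `d ∈ D` of the
transitive tournaments with vertices `d_1, …, d_ℓ` and edges `d_i ← d_j` for `i < j`. -/
def relationGraph (D : Finset (List ℕ)) : FactorGraph where
  verts := D.biUnion fun d => Finset.univ.image (vertexAt d)
  Adj x y := ∃ d ∈ D, ∃ i j : Fin d.length, i < j ∧ y = vertexAt d i ∧ x = vertexAt d j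
  adj_left := by
    rintro x y ⟨d, hd, i, j, -, -, rfl⟩
    exact Finset.mem_biUnion.2 ⟨d, hd, Finset.mem_image_of_mem _ (Finset.mem_univ j)⟩
  adj_right := by
    rintro x y ⟨d, hd, i, j, -, rfl, -⟩
    exact Finset.mem_biUnion.2 ⟨d, hd, Finset.mem_image_of_mem _ (Finset.mem_univ i)⟩

namespace FactorGraph

/-- The subgraph of `G` induced on the vertices of `G` in `S`. -/
def induce (G : FactorGraph) (S : Finset Vertex) : FactorGraph where
  verts := G.verts ∩ S
  Adj x y := G.Adj x y ∧ x ∈ S ∧ y ∈ S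
  adj_left x y h := Finset.mem_inter.2 ⟨G.adj_left x y h.1, h.2.1⟩
  adj_right x y h := Finset.mem_inter.2 ⟨G.adj_right x y h.1, h.2.2⟩

/-- There is a (possibly empty) directed path in `G` from `x` to `y`. -/
def Reachable (G : FactorGraph) (x y : Vertex) : Prop :=
  Relation.ReflTransGen G.Adj x y

open Classical in
/-- The strongly connected component of a vertex `v`: the subgraph induced on all vertices that
are connected with `v` by directed paths in both directions. -/
noncomputable def component (G : FactorGraph) (v : Vertex) : FactorGraph :=
  G.induce (G.verts.filter fun w => G.Reachable v w ∧ G.Reachable w v)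

/-- `H` is a strongly connected component of `G`. -/
def IsStrongComponent (G H : FactorGraph) : Prop :=
  ∃ v ∈ G.verts, H = G.component v

/-- `[G_1, …, G_ℓ]` lists the strongly connected components of `G`, each exactly once, and
`G_1 ← G_2 ← ⋯ ← G_ℓ`: for consecutive components there is an edge of `G` from a vertex of
`G_{i+1}` to a vertex of `G_i`. -/
structure IsComponentChain (G : FactorGraph) (Gs : List FactorGraph) : Prop where
  nodup : Gs.Nodup
  mem_iff : ∀ H, H ∈ Gs ↔ G.IsStrongComponent H
  chain : List.IsChain (fun H K => ∃ u ∈ H.verts, ∃ v ∈ K.verts, G.Adj v u) Gs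

/-- `e_1 ← ⋯ ← e_ℓ` is a transitive Hamiltonian path in `G`: it visits each vertex of `G`
exactly once and `e_i ← e_j` is an edge of `G` for all `i < j`. -/
structure IsTransitiveHamiltonianPath (G : FactorGraph) (e : List Vertex) : Prop where
  nodup : e.Nodup
  mem_iff : ∀ v, v ∈ e ↔ v ∈ G.verts
  transitive : e.Pairwise fun a b => G.Adj b a

/-- The product of (the values of) all vertices of `G`. -/
def degree (G : FactorGraph) : ℕ := ∏ v ∈ G.verts, v.value

end FactorGraph

/-! ### Polynomials and their compositions -/

variable (F : Type*) [Field F]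

/-- The monic original polynomials of degree `n`. -/
def monicOriginal (n : ℕ) : Set F[X] :=
  {f | f.Monic ∧ f.eval 0 = 0 ∧ f.natDegree = n}

variable {F}

/-- The composition `g_1 ∘ g_2 ∘ ⋯ ∘ g_ℓ` (equal to `X` for `ℓ = 0`). -/
noncomputable def compList (gs : List F[X]) : F[X] :=
  gs.foldr Polynomial.comp X

/-- The composition `S_1 ∘ ⋯ ∘ S_ℓ` of sets of polynomials: all `g_1 ∘ ⋯ ∘ g_ℓ` with
`g_i ∈ S_i`. -/
def compSets (Ss : List (Set F[X])) : Set F[X] :=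
  {f | ∃ gs : List F[X], List.Forall₂ (fun g S => g ∈ S) gs Ss ∧ f = compList gs}

variable (F)

/-- The set `𝒟_G` of all monic original `f`, of degree the product of the vertices of `G`, such that
for every transitive Hamiltonian path `e_1 ← ⋯ ← e_ℓ` in `G` there is a decomposition
`f = g_1 ∘ ⋯ ∘ g_ℓ` into monic original polynomials with `deg g_i = e_i`. -/
def collisions (G : FactorGraph) : Set F[X] :=
  {f | f ∈ monicOriginal F G.degree ∧
    ∀ e : List Vertex, G.IsTransitiveHamiltonianPath e →
      f ∈ compSets (e.map fun v => monicOriginal F v.value)}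

end TameCollision

/-! A relation graph `G` is semicomplete, and each `d` in the defining set `D` is a transitive
Hamiltonian path of it (`relationGraph_exists_path`); the rest of the argument applies to every graph
that has such a path.

On the combinatorial side, in a chain `G_1 ← ⋯ ← G_ℓ` of strong components every vertex of `G_j` has
an edge to every vertex of `G_i` for `i < j`, and no edge leads back (`IsComponentChain.pairwise`).
Hence the transitive Hamiltonian paths of `G` are exactly the concatenations of transitive Hamiltonian
paths of the `G_i` (`IsComponentChain.isTransitiveHamiltonianPath_flatten`,
`IsComponentChain.flatten_filter_eq`). This gives `𝒟_{G_1} ∘ ⋯ ∘ 𝒟_{G_ℓ} ⊆ 𝒟_G` at once.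

On the algebraic side, a tame decomposition into monic original polynomials is determined by the
degrees of its components (`eq_of_comp_eq_comp`, `eq_of_compList_eq`). Given `f ∈ 𝒟_G`, the
decomposition `f = g_1 ∘ ⋯ ∘ g_ℓ` with `deg g_i` the degree of `G_i` is therefore independent of the
path from which it is read off. Replacing the `i`-th block of a path by an arbitrary path of `G_i`
leaves `g_i` unchanged, so `g_i ∈ 𝒟_{G_i}`. The same uniqueness makes composition injective on
`𝒟_{G_1} × ⋯ × 𝒟_{G_ℓ}`, whence the counting formula. -/

namespace TameCollision

/-! ### Uniqueness of tame decompositions -/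

section Decomposition

variable {F : Type*} [Field F]

/-- The coefficients of `g ∘ h` above degree `(r - 1) * s` depend only on `h`. -/
theorem natDegree_comp_sub_pow_le {g h : F[X]} {r s : ℕ} (hg : g ∈ monicOriginal F r)
    (hh : h.natDegree = s) : (g.comp h - h ^ r).natDegree ≤ (r - 1) * s := by
  obtain ⟨hm, -, hr⟩ := hg
  have key : g.comp h - h ^ r = g.eraseLead.comp h := by
    conv_lhs => rw [← g.eraseLead_add_C_mul_X_pow]
    simp [hm.leadingCoeff, hr]
  rw [key, natDegree_comp, hh]
  gcongr
  exact hr ▸ eraseLead_natDegree_le g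

/-- The components of a tame decomposition are determined by their degrees. -/
theorem eq_of_comp_eq_comp {g g' h h' : F[X]} {r s : ℕ} (hg : g ∈ monicOriginal F r)
    (hg' : g' ∈ monicOriginal F r) (hh : h ∈ monicOriginal F s) (hh' : h' ∈ monicOriginal F s)
    (hr : (r : F) ≠ 0) (hs : s ≠ 0) (H : g.comp h = g'.comp h') : g = g' ∧ h = h' := by
  have heq : h = h' := by
    by_contra hne
    have hr0 : r ≠ 0 := by rintro rfl; simp at hr
    -- The powers `h ^ r` and `h' ^ r` agree above degree `(r - 1) * s`.
    have hle : (h ^ r - h' ^ r).natDegree ≤ (r - 1) * s := by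
      have : h ^ r - h' ^ r = (g'.comp h' - h' ^ r) - (g.comp h - h ^ r) := by rw [H]; ring
      rw [this]
      exact (natDegree_sub_le _ _).trans
        (max_le (natDegree_comp_sub_pow_le hg' hh'.2.2) (natDegree_comp_sub_pow_le hg hh.2.2))
    -- The cofactor of `h - h'` has degree exactly `(r - 1) * s`: its top coefficient is `r`.
    set S : F[X] := ∑ i ∈ Finset.range r, h ^ i * h' ^ (r - 1 - i) with hS
    have hcoeff : S.coeff ((r - 1) * s) = r := by
      rw [hS, finsetSum_coeff, Finset.sum_congr rfl (g := fun _ => (1 : F)), Finset.sum_const,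
        Finset.card_range, nsmul_one]
      intro i hi
      have hi' := Finset.mem_range.1 hi
      have hm : (h ^ i * h' ^ (r - 1 - i)).Monic := (hh.1.pow i).mul (hh'.1.pow _)
      have hd : (h ^ i * h' ^ (r - 1 - i)).natDegree = (r - 1) * s := by
        rw [(hh.1.pow i).natDegree_mul (hh'.1.pow _), hh.1.natDegree_pow, hh'.1.natDegree_pow,
          hh.2.2, hh'.2.2, ← add_mul]
        congr 1
        omega
      rw [← hd]
      exact hm.coeff_natDegree
    have hSdeg : (r - 1) * s ≤ S.natDegree := le_natDegree_of_ne_zero (hcoeff ▸ hr)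
    have hS0 : S ≠ 0 := by
      rintro h0
      rw [h0, coeff_zero] at hcoeff
      exact hr hcoeff.symm
    have hfac : S * (h - h') = h ^ r - h' ^ r := Commute.geom_sum₂_mul (Commute.all _ _) r
    rw [← hfac, natDegree_mul hS0 (sub_ne_zero.2 hne)] at hle
    -- So `h - h'` is constant, and it vanishes at `0`.
    have hconst := eq_C_of_natDegree_eq_zero (p := h - h') (by omega)
    rw [coeff_zero_eq_eval_zero, eval_sub, hh.2.1, hh'.2.1, sub_zero, C_0] at hconst
    exact hne (sub_eq_zero.1 hconst)
  subst heq
  refine ⟨?_, rfl⟩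
  have h0 : (g - g').comp h = 0 := by rw [sub_comp, H, sub_self]
  rcases comp_eq_zero_iff.1 h0 with h1 | ⟨-, h1⟩
  · exact sub_eq_zero.1 h1
  · exact absurd (h1 ▸ natDegree_C _ : h.natDegree = 0) (hh.2.2 ▸ hs)

theorem comp_mem_monicOriginal {g h : F[X]} {r s : ℕ} (hg : g ∈ monicOriginal F r)
    (hh : h ∈ monicOriginal F s) (hs : s ≠ 0) : g.comp h ∈ monicOriginal F (r * s) :=
  ⟨hg.1.comp hh.1 (hh.2.2 ▸ hs), by rw [eval_comp, hh.2.1, hg.2.1],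
    by rw [natDegree_comp, hg.2.2, hh.2.2]⟩

theorem X_mem_monicOriginal : (X : F[X]) ∈ monicOriginal F 1 :=
  ⟨monic_X, eval_X, natDegree_X⟩

theorem compList_mem_monicOriginal {ns : List ℕ} (h0 : 0 ∉ ns) {gs : List F[X]}
    (h : List.Forall₂ (fun g n => g ∈ monicOriginal F n) gs ns) :
    compList gs ∈ monicOriginal F ns.prod := by
  induction h with
  | nil => exact X_mem_monicOriginal
  | cons hg _ ih =>
    rw [List.mem_cons, not_or] at h0
    rw [List.prod_cons]
    exact comp_mem_monicOriginal hg (ih h0.2) (fun h => h0.2 (List.prod_eq_zero_iff.1 h))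

/-- A tame decomposition of any length is determined by the degrees of its components. -/
theorem eq_of_compList_eq {ns : List ℕ} (hns : (ns.prod : F) ≠ 0) {gs gs' : List F[X]}
    (h : List.Forall₂ (fun g n => g ∈ monicOriginal F n) gs ns)
    (h' : List.Forall₂ (fun g n => g ∈ monicOriginal F n) gs' ns)
    (H : compList gs = compList gs') : gs = gs' := by
  induction h generalizing gs' with
  | nil => exact (List.forall₂_nil_right_iff.1 h').symm
  | @cons g n gs ns hg hgs ih =>
    obtain ⟨g', gs', hg', hgs', rfl⟩ := List.forall₂_cons_right_iff.1 h'
    rw [List.prod_cons, Nat.cast_mul] at hns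
    have h0 : ns.prod ≠ 0 := fun h => right_ne_zero_of_mul hns (by rw [h, Nat.cast_zero])
    have h0' : 0 ∉ ns := fun h => h0 (List.prod_eq_zero_iff.2 h)
    obtain ⟨rfl, h2⟩ := eq_of_comp_eq_comp hg hg' (compList_mem_monicOriginal h0' hgs)
      (compList_mem_monicOriginal h0' hgs') (left_ne_zero_of_mul hns) h0 H
    rw [ih (right_ne_zero_of_mul hns) hgs' h2]

theorem finite_monicOriginal [Finite F] (n : ℕ) : (monicOriginal F n).Finite := by
  refine Set.Finite.subset (s := (degreeLT F (n + 1) : Set F[X])) ?_ fun f hf => ?_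
  · have : Finite (degreeLT F (n + 1)) := Finite.of_equiv _ (degreeLTEquiv F (n + 1)).symm.toEquiv
    exact Set.toFinite _
  · refine mem_degreeLT.2 (degree_le_natDegree.trans_lt ?_)
    rw [hf.2.2]
    exact_mod_cast n.lt_succ_self

/-! ### Compositions of sets of polynomials -/

theorem compSets_nil : compSets ([] : List (Set F[X])) = {X} := by
  ext f
  simp [compSets, compList]

theorem compSets_cons (S : Set F[X]) (Ss : List (Set F[X])) :
    compSets (S :: Ss) = Set.image2 comp S (compSets Ss) := by
  ext f
  constructor
  · rintro ⟨gs, h, rfl⟩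
    obtain ⟨g, gs, hg, hgs, rfl⟩ := List.forall₂_cons_right_iff.1 h
    exact ⟨g, hg, _, ⟨gs, hgs, rfl⟩, rfl⟩
  · rintro ⟨g, hg, _, ⟨gs, hgs, rfl⟩, rfl⟩
    exact ⟨g :: gs, hgs.cons hg, rfl⟩

theorem compSets_append (Ss Ts : List (Set F[X])) :
    compSets (Ss ++ Ts) = Set.image2 comp (compSets Ss) (compSets Ts) := by
  induction Ss with
  | nil => simp [compSets_nil]
  | cons S Ss ih =>
    rw [List.cons_append, compSets_cons, compSets_cons, ih]
    exact (Set.image2_assoc fun a b c => comp_assoc a b c).symm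

theorem compSets_flatten (L : List (List (Set F[X]))) :
    compSets L.flatten = compSets (L.map compSets) := by
  induction L with
  | nil => rfl
  | cons Ss L ih => rw [List.flatten_cons, compSets_append, List.map_cons, compSets_cons, ih]

theorem mem_compSets_map {α : Type*} {f : F[X]} {S : α → Set F[X]} {l : List α} :
    f ∈ compSets (l.map S) ↔
      ∃ gs : List F[X], List.Forall₂ (fun g a => g ∈ S a) gs l ∧ f = compList gs := by
  simp only [compSets, List.forall₂_map_right_iff, Set.mem_ofPred_eq]

theorem compSets_monicOriginal_subset {ns : List ℕ} (h0 : 0 ∉ ns) :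
    compSets (ns.map (monicOriginal F)) ⊆ monicOriginal F ns.prod := by
  intro f hf
  obtain ⟨gs, h, rfl⟩ := mem_compSets_map.1 hf
  exact compList_mem_monicOriginal h0 h

theorem ncard_compSets {α : Type*} {S : α → Set F[X]} {deg : α → ℕ} {l : List α}
    (hS : ∀ a ∈ l, S a ⊆ monicOriginal F (deg a)) (hl : ((l.map deg).prod : F) ≠ 0) :
    (compSets (l.map S)).ncard = (l.map fun a => (S a).ncard).prod := by
  induction l with
  | nil => simp [compSets_nil]
  | cons a l ih =>
    rw [List.forall_mem_cons] at hS
    rw [List.map_cons, List.prod_cons, Nat.cast_mul] at hl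
    have h0 : (l.map deg).prod ≠ 0 := fun h => right_ne_zero_of_mul hl (by rw [h, Nat.cast_zero])
    have h0' : 0 ∉ l.map deg := fun h => h0 (List.prod_eq_zero_iff.2 h)
    have hsub : compSets (l.map S) ⊆ monicOriginal F (l.map deg).prod := by
      intro f hf
      obtain ⟨gs, h, rfl⟩ := mem_compSets_map.1 hf
      refine compList_mem_monicOriginal h0' (List.forall₂_map_right_iff.2 ?_)
      rw [List.forall₂_iff_zip] at h ⊢
      exact ⟨h.1, fun hab => hS.2 _ (List.of_mem_zip hab).2 (h.2 hab)⟩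
    rw [List.map_cons, compSets_cons, ← Set.image_uncurry_prod, Set.InjOn.ncard_image,
      Set.ncard_prod, ih hS.2 (right_ne_zero_of_mul hl), List.map_cons, List.prod_cons]
    rintro ⟨g, h⟩ hgh ⟨g', h'⟩ hgh' H
    obtain ⟨rfl, rfl⟩ := eq_of_comp_eq_comp (hS.1 hgh.1) (hS.1 hgh'.1) (hsub hgh.2) (hsub hgh'.2)
      (left_ne_zero_of_mul hl) h0 H
    rfl

end Decomposition

/-! ### Strong components and transitive Hamiltonian paths -/

namespace FactorGraph

variable {G : FactorGraph} {Gs : List FactorGraph} {e : List Vertex} {u v w : Vertex}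

theorem mem_component_verts :
    w ∈ (G.component v).verts ↔ w ∈ G.verts ∧ G.Reachable v w ∧ G.Reachable w v := by
  simp [component, induce]

theorem mem_component_self (hv : v ∈ G.verts) : v ∈ (G.component v).verts :=
  mem_component_verts.2 ⟨hv, .refl, .refl⟩

theorem component_adj :
    (G.component v).Adj u w ↔
      G.Adj u w ∧ u ∈ (G.component v).verts ∧ w ∈ (G.component v).verts := by
  constructor
  · exact fun h => ⟨h.1, (G.component v).adj_left _ _ h, (G.component v).adj_right _ _ h⟩
  · rintro ⟨h, hu, hw⟩
    exact ⟨h, (Finset.mem_inter.1 hu).2, (Finset.mem_inter.1 hw).2⟩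

theorem component_eq_of_reachable (huv : G.Reachable u v) (hvu : G.Reachable v u) :
    G.component u = G.component v := by
  classical
  have : ∀ w, (G.Reachable u w ∧ G.Reachable w u) ↔ (G.Reachable v w ∧ G.Reachable w v) :=
    fun w => ⟨fun h => ⟨hvu.trans h.1, h.2.trans huv⟩, fun h => ⟨huv.trans h.1, h.2.trans hvu⟩⟩
  simp only [component, this]

theorem IsStrongComponent.eq_component {H : FactorGraph} (hH : G.IsStrongComponent H)
    (hv : v ∈ H.verts) : H = G.component v := by
  obtain ⟨u, -, rfl⟩ := hH
  exact component_eq_of_reachable (mem_component_verts.1 hv).2.1 (mem_component_verts.1 hv).2.2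

theorem IsStrongComponent.mem_verts {H : FactorGraph} (hH : G.IsStrongComponent H)
    (hv : v ∈ H.verts) : v ∈ G.verts := by
  obtain ⟨u, -, rfl⟩ := hH
  exact (mem_component_verts.1 hv).1

theorem IsStrongComponent.nonempty {H : FactorGraph} (hH : G.IsStrongComponent H) :
    ∃ v, v ∈ H.verts := by
  obtain ⟨v, hv, rfl⟩ := hH
  exact ⟨v, mem_component_self hv⟩

theorem IsStrongComponent.adj_iff {H : FactorGraph} (hH : G.IsStrongComponent H) :
    H.Adj u v ↔ G.Adj u v ∧ u ∈ H.verts ∧ v ∈ H.verts := by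
  obtain ⟨w, -, rfl⟩ := hH
  exact component_adj

/-- A graph with a transitive Hamiltonian path is semicomplete. -/
theorem IsTransitiveHamiltonianPath.adj_or_adj (he : G.IsTransitiveHamiltonianPath e)
    (hu : u ∈ G.verts) (hv : v ∈ G.verts) (huv : u ≠ v) : G.Adj u v ∨ G.Adj v u := by
  have : Std.Symm fun a b => G.Adj a b ∨ G.Adj b a := ⟨fun _ _ h => h.symm⟩
  exact (he.transitive.imp (S := fun a b => G.Adj a b ∨ G.Adj b a) Or.inr).forall
    ((he.mem_iff u).2 hu) ((he.mem_iff v).2 hv) huv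

theorem IsTransitiveHamiltonianPath.degree_eq (he : G.IsTransitiveHamiltonianPath e) :
    G.degree = (e.map Vertex.value).prod := by
  rw [← List.prod_toFinset _ he.nodup, degree]
  congr 1
  ext v
  simp [he.mem_iff]

theorem IsTransitiveHamiltonianPath.filter (he : G.IsTransitiveHamiltonianPath e)
    {H : FactorGraph} (hH : G.IsStrongComponent H) :
    H.IsTransitiveHamiltonianPath (e.filter (· ∈ H.verts)) where
  nodup := he.nodup.filter _
  mem_iff v := by
    simp only [List.mem_filter, decide_eq_true_eq, he.mem_iff, and_iff_right_iff_imp]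
    exact hH.mem_verts
  transitive := (he.transitive.filter _).imp_of_mem fun ha hb h => by
    simp only [List.mem_filter, decide_eq_true_eq] at ha hb
    exact hH.adj_iff.2 ⟨h, hb.2, ha.2⟩

/-- The strong components of a graph with a transitive Hamiltonian path form a chain: they are
sorted by the number of vertices that can be reached from them. -/
theorem IsTransitiveHamiltonianPath.exists_isComponentChain
    (he : G.IsTransitiveHamiltonianPath e) : ∃ Gs, G.IsComponentChain Gs := by
  classical
  let R : FactorGraph → Finset Vertex := fun H =>
    G.verts.filter fun w => ∃ v ∈ H.verts, G.Reachable v w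
  let r : FactorGraph → FactorGraph → Prop := fun H K => (R H).card ≤ (R K).card
  have : Std.Total r := ⟨fun H K => le_total (R H).card (R K).card⟩
  have : IsTrans FactorGraph r := ⟨fun _ _ _ h₁ h₂ => le_trans (α := ℕ) h₁ h₂⟩
  let Gs := (G.verts.image G.component).toList.insertionSort r
  have hperm : Gs.Perm (G.verts.image G.component).toList := List.perm_insertionSort _ _
  have hmem : ∀ H, H ∈ Gs ↔ G.IsStrongComponent H := fun H => by
    rw [hperm.mem_iff, Finset.mem_toList, Finset.mem_image]
    exact ⟨fun ⟨v, hv, h⟩ => ⟨v, hv, h.symm⟩, fun ⟨v, hv, h⟩ => ⟨v, hv, h.symm⟩⟩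
  have hnodup : Gs.Nodup := hperm.nodup_iff.2 (Finset.nodup_toList _)
  refine ⟨Gs, hnodup, hmem, List.Pairwise.isChain ?_⟩
  refine ((List.pairwise_insertionSort r _).and hnodup).imp_of_mem fun {H K} hH hK h => ?_
  rw [hmem] at hH hK
  obtain ⟨u, hu⟩ := hH.nonempty
  obtain ⟨v, hv⟩ := hK.nonempty
  refine ⟨u, hu, v, hv, ?_⟩
  have hne : u ≠ v := by
    rintro rfl
    exact h.2 ((hH.eq_component hu).trans (hK.eq_component hv).symm)
  refine (he.adj_or_adj (hH.mem_verts hu) (hK.mem_verts hv) hne).resolve_left fun huv => h.2 ?_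
  -- With an edge from `u` to `v`, everything reachable from `K` is reachable from `H`; comparing
  -- cardinalities, `u` is reachable from `K`.
  have hsub : R K ⊆ R H := fun w hw => by
    simp only [R, Finset.mem_filter] at hw ⊢
    obtain ⟨hw, v', hv', hr⟩ := hw
    rw [hK.eq_component hv] at hv'
    exact ⟨hw, u, hu, .head huv ((mem_component_verts.1 hv').2.1.trans hr)⟩
  have huR : u ∈ R K := by
    rw [Finset.eq_of_subset_of_card_le hsub h.1]
    exact Finset.mem_filter.2 ⟨hH.mem_verts hu, u, hu, .refl⟩
  obtain ⟨v', hv', hr⟩ := (Finset.mem_filter.1 huR).2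
  rw [hK.eq_component hv] at hv'
  rw [hH.eq_component hu, hK.eq_component hv]
  exact component_eq_of_reachable (.single huv) ((mem_component_verts.1 hv').2.1.trans hr)

/-- All edges between distinct components of a chain lead from the later to the earlier one, and
any two vertices of distinct components are joined by such an edge. -/
theorem IsComponentChain.pairwise (hGs : G.IsComponentChain Gs)
    (he : G.IsTransitiveHamiltonianPath e) :
    Gs.Pairwise fun H K => ∀ u ∈ H.verts, ∀ v ∈ K.verts, u ≠ v ∧ G.Adj v u ∧ ¬ G.Adj u v := by
  -- Requiring strong components, which are not empty, makes the relation transitive.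
  let r : FactorGraph → FactorGraph → Prop := fun H K =>
    G.IsStrongComponent H ∧ G.IsStrongComponent K ∧
      ∀ u ∈ H.verts, ∀ v ∈ K.verts, G.Reachable v u
  have : IsTrans FactorGraph r := ⟨fun H K L h₁ h₂ => ⟨h₁.1, h₂.2.1, fun u hu w hw => by
    obtain ⟨v, hv⟩ := h₁.2.1.nonempty
    exact (h₂.2.2 v hv w hw).trans (h₁.2.2 u hu v hv)⟩⟩
  have hr : Gs.Pairwise r := by
    refine List.IsChain.pairwise (List.IsChain.imp_of_mem_imp (fun H K hH hK h => ?_) hGs.chain)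
    rw [hGs.mem_iff] at hH hK
    obtain ⟨u, hu, v, hv, huv⟩ := h
    refine ⟨hH, hK, fun u' hu' v' hv' => ?_⟩
    rw [hH.eq_component hu, mem_component_verts] at hu'
    rw [hK.eq_component hv, mem_component_verts] at hv'
    exact (hv'.2.2.tail huv).trans hu'.2.1
  refine (hr.and hGs.nodup).imp fun {H K} h u hu v hv => ?_
  obtain ⟨⟨hH, hK, h⟩, hne⟩ := h
  have hadj : ¬ G.Adj u v := fun huv => hne <| by
    rw [hH.eq_component hu, hK.eq_component hv]
    exact component_eq_of_reachable (.single huv) (h u hu v hv)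
  have huv : u ≠ v := by
    rintro rfl
    exact hne ((hH.eq_component hu).trans (hK.eq_component hv).symm)
  exact ⟨huv, (he.adj_or_adj (hH.mem_verts hu) (hK.mem_verts hv) huv).resolve_left hadj, hadj⟩

theorem IsComponentChain.isTransitiveHamiltonianPath_flatten (hGs : G.IsComponentChain Gs)
    (he : G.IsTransitiveHamiltonianPath e) {E : FactorGraph → List Vertex}
    (hE : ∀ H ∈ Gs, H.IsTransitiveHamiltonianPath (E H)) :
    G.IsTransitiveHamiltonianPath (Gs.map E).flatten where
  nodup := by
    rw [List.nodup_flatten, List.forall_mem_map, List.pairwise_map]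
    refine ⟨fun H hH => (hE H hH).nodup, (hGs.pairwise he).imp_of_mem fun hH hK h v hv hv' => ?_⟩
    exact (h v (((hE _ hH).mem_iff v).1 hv) v (((hE _ hK).mem_iff v).1 hv')).1 rfl
  mem_iff v := by
    simp only [List.mem_flatten, List.mem_map, exists_exists_and_eq_and]
    constructor
    · rintro ⟨H, hH, hv⟩
      exact ((hGs.mem_iff H).1 hH).mem_verts (((hE H hH).mem_iff v).1 hv)
    · intro hv
      have hH := (hGs.mem_iff _).2 ⟨v, hv, rfl⟩
      exact ⟨_, hH, ((hE _ hH).mem_iff v).2 (mem_component_self hv)⟩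
  transitive := by
    rw [List.pairwise_flatten, List.forall_mem_map, List.pairwise_map]
    refine ⟨fun H hH => (hE H hH).transitive.imp fun h =>
      (((hGs.mem_iff H).1 hH).adj_iff.1 h).1, (hGs.pairwise he).imp_of_mem
        fun hH hK h u hu v hv => ?_⟩
    exact (h u (((hE _ hH).mem_iff u).1 hu) v (((hE _ hK).mem_iff v).1 hv)).2.1

/-- A transitive Hamiltonian path visits the components of a chain one after the other. -/
theorem IsComponentChain.flatten_filter_eq (hGs : G.IsComponentChain Gs)
    (he : G.IsTransitiveHamiltonianPath e) :
    (Gs.map fun H => e.filter (· ∈ H.verts)).flatten = e := by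
  have hE := fun H hH => he.filter ((hGs.mem_iff H).1 hH)
  have hfl := hGs.isTransitiveHamiltonianPath_flatten he hE
  -- Both lists are sorted with respect to the positions of the vertices in `e`.
  have hsort : e.Pairwise fun a b => e.idxOf a < e.idxOf b := by
    rw [List.pairwise_iff_getElem]
    intro i j hi hj hij
    rwa [he.nodup.idxOf_getElem i hi, he.nodup.idxOf_getElem j hj]
  refine List.Perm.eq_of_pairwise (le := fun a b => e.idxOf a < e.idxOf b)
    (fun a b _ _ h h' => absurd h h'.asymm) ?_ hsort
    ((List.perm_ext_iff_of_nodup hfl.nodup he.nodup).2 fun v => by rw [hfl.mem_iff, he.mem_iff])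
  rw [List.pairwise_flatten, List.forall_mem_map, List.pairwise_map]
  refine ⟨fun H hH => hsort.filter _, (hGs.pairwise he).imp fun h u hu v hv => ?_⟩
  simp only [List.mem_filter, decide_eq_true_eq] at hu hv
  obtain ⟨hne, -, hadj⟩ := h u hu.2 v hv.2
  by_contra hlt
  have hu' := List.idxOf_lt_length_of_mem hu.1
  have hv' := List.idxOf_lt_length_of_mem hv.1
  have hlt' : e.idxOf v < e.idxOf u := lt_of_le_of_ne (not_lt.1 hlt) fun h =>
    hne ((List.idxOf_inj hu.1).1 h.symm)
  have := List.pairwise_iff_getElem.1 he.transitive _ _ hv' hu' hlt'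
  rw [List.getElem_idxOf, List.getElem_idxOf] at this
  exact hadj this

theorem IsComponentChain.prod_degree (hGs : G.IsComponentChain Gs)
    (he : G.IsTransitiveHamiltonianPath e) : (Gs.map degree).prod = G.degree := by
  have hE := fun H hH => he.filter ((hGs.mem_iff H).1 hH)
  rw [(hGs.isTransitiveHamiltonianPath_flatten he hE).degree_eq, List.map_flatten,
    List.prod_flatten, List.map_map, List.map_map]
  exact congrArg List.prod (List.map_congr_left fun H hH => (hE H hH).degree_eq)

end FactorGraph

/-! ### Collisions along a chain of components -/

section Collisions

open FactorGraph

variable {F : Type*} [Field F] {G : FactorGraph} {Gs : List FactorGraph} {e : List Vertex}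

theorem forall₂_mem_monicOriginal_of_collisions {gs : List F[X]}
    (h : List.Forall₂ (fun g H => g ∈ collisions F H) gs Gs) :
    List.Forall₂ (fun g n => g ∈ monicOriginal F n) gs (Gs.map degree) :=
  List.forall₂_map_right_iff.2 (h.imp fun _ _ hg => hg.1)

theorem compSets_collisions_subset (hGs : G.IsComponentChain Gs)
    (he : G.IsTransitiveHamiltonianPath e) (hdeg : G.degree ≠ 0) :
    compSets (Gs.map (collisions F)) ⊆ collisions F G := by
  intro f hf
  obtain ⟨gs, hgs, rfl⟩ := mem_compSets_map.1 hf
  have hprod := hGs.prod_degree he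
  refine ⟨?_, fun e' he' => ?_⟩
  · rw [← hprod]
    refine compList_mem_monicOriginal (fun h => hdeg ?_) (forall₂_mem_monicOriginal_of_collisions hgs)
    rw [← hprod]
    exact List.prod_eq_zero_iff.2 h
  · rw [← hGs.flatten_filter_eq he', List.map_flatten, List.map_map, compSets_flatten, List.map_map]
    refine mem_compSets_map.2 ⟨gs, ?_, rfl⟩
    rw [List.forall₂_iff_zip] at hgs ⊢
    refine ⟨hgs.1, fun hab => (hgs.2 hab).2 _ (he'.filter ?_)⟩
    exact (hGs.mem_iff _).1 (List.of_mem_zip hab).2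

theorem collisions_subset_compSets (hGs : G.IsComponentChain Gs)
    (he : G.IsTransitiveHamiltonianPath e) (hdeg : (G.degree : F) ≠ 0) :
    collisions F G ⊆ compSets (Gs.map (collisions F)) := by
  classical
  intro f hf
  have hprod := hGs.prod_degree he
  -- A choice `E` of paths for all components yields a decomposition of `f`.
  have hdec : ∀ E : FactorGraph → List Vertex, (∀ H ∈ Gs, H.IsTransitiveHamiltonianPath (E H)) →
      ∃ gs : List F[X], List.Forall₂
        (fun g H => g ∈ compSets ((E H).map fun v => monicOriginal F v.value)) gs Gs ∧
          f = compList gs := fun E hE => by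
    have := hf.2 _ (hGs.isTransitiveHamiltonianPath_flatten he hE)
    rw [List.map_flatten, List.map_map, compSets_flatten, List.map_map] at this
    exact mem_compSets_map.1 this
  -- Its components have the degrees of the `G_i`, whatever the choice.
  have hmo : ∀ E : FactorGraph → List Vertex, (∀ H ∈ Gs, H.IsTransitiveHamiltonianPath (E H)) →
      ∀ gs : List F[X], List.Forall₂
        (fun g H => g ∈ compSets ((E H).map fun v => monicOriginal F v.value)) gs Gs →
          List.Forall₂ (fun g n => g ∈ monicOriginal F n) gs (Gs.map degree) :=
      fun E hE gs h => by
    rw [List.forall₂_map_right_iff]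
    rw [List.forall₂_iff_zip] at h ⊢
    refine ⟨h.1, fun {g H} hab => ?_⟩
    have hH := (List.of_mem_zip hab).2
    have hHdeg : H.degree ≠ 0 := fun h0 => hdeg <| by
      rw [← hprod, List.prod_eq_zero_iff.2 (List.mem_map.2 ⟨H, hH, h0⟩), Nat.cast_zero]
    have hg := h.2 hab
    rw [(hE H hH).degree_eq] at hHdeg ⊢
    refine compSets_monicOriginal_subset (fun h0 => hHdeg (List.prod_eq_zero_iff.2 h0)) ?_
    rwa [List.map_map]
  have hE₀ : ∀ H ∈ Gs, H.IsTransitiveHamiltonianPath (e.filter (· ∈ H.verts)) :=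
    fun H hH => he.filter ((hGs.mem_iff H).1 hH)
  obtain ⟨gs, hgs, rfl⟩ := hdec _ hE₀
  have hgs' := hmo _ hE₀ gs hgs
  refine mem_compSets_map.2 ⟨gs, ?_, rfl⟩
  refine List.forall₂_iff_zip.2 ⟨hgs.length_eq, fun {g H} hab => ⟨?_, fun e' he' => ?_⟩⟩
  · exact (List.forall₂_iff_zip.1 (List.forall₂_map_right_iff.1 hgs')).2 hab
  · -- Replace the path of the component `H` by `e'`; the decomposition stays the same.
    let E := Function.update (fun K : FactorGraph => e.filter (· ∈ K.verts)) H e'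
    have hE : ∀ K ∈ Gs, K.IsTransitiveHamiltonianPath (E K) := fun K hK => by
      by_cases h : K = H
      · subst h
        simpa [E] using he'
      · simpa [E, h] using hE₀ K hK
    obtain ⟨gs₁, h₁, heq⟩ := hdec E hE
    obtain rfl := eq_of_compList_eq (hprod ▸ hdeg) hgs' (hmo E hE gs₁ h₁) heq
    simpa [E] using (List.forall₂_iff_zip.1 h₁).2 hab

end Collisions

/-! ### Relation graphs -/

theorem vertexAt_injective (d : List ℕ) : Function.Injective (vertexAt d) := by
  have key : ∀ i j : Fin d.length, i < j → vertexAt d i ≠ vertexAt d j := fun i j hij h => by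
    obtain ⟨h₁, h₂⟩ := Prod.ext_iff.1 h
    simp only [vertexAt] at h₁ h₂
    rw [← h₁] at h₂
    -- The entry at position `i` itself is counted at position `j`.
    have : (d.take (i + 1)).count (d.get i) ≤ (d.take j).count (d.get i) :=
      (List.take_sublist_take_left (Nat.succ_le_of_lt hij)).count_le _
    rw [List.take_succ_eq_append_getElem i.2, List.count_append] at this
    simp at this h₂
    omega
  intro i j h
  rcases lt_trichotomy i j with hij | hij | hij
  · exact absurd h (key i j hij)
  · exact hij
  · exact absurd h.symm (key j i hij)

/-- The vertices of `d` depend only on the multiset of its entries. -/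
theorem exists_vertexAt_eq_iff {d : List ℕ} {v : Vertex} :
    (∃ i, vertexAt d i = v) ↔ v.2 < d.count v.1 := by
  constructor
  · rintro ⟨i, rfl⟩
    have : (d.take (i + 1)).count (d.get i) ≤ d.count (d.get i) :=
      (List.take_sublist _ _).count_le _
    rw [List.take_succ_eq_append_getElem i.2, List.count_append] at this
    simp [vertexAt] at this ⊢
    omega
  · induction d generalizing v with
    | nil => simp
    | cons b d ih =>
      obtain ⟨a, k⟩ := v
      intro h
      by_cases hb : b = a
      · subst hb
        cases k with
        | zero => exact ⟨⟨0, by simp⟩, by simp [vertexAt]⟩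
        | succ k =>
          obtain ⟨i, hi⟩ := ih (v := (b, k)) (by simpa using h)
          obtain ⟨h₁, h₂⟩ := Prod.ext_iff.1 hi
          simp only [vertexAt, List.get_eq_getElem] at h₁ h₂
          refine ⟨i.succ, ?_⟩
          simp [vertexAt, h₁] at h₂ ⊢
          exact h₂
      · obtain ⟨i, hi⟩ := ih (v := (a, k)) (by simpa [List.count_cons_of_ne hb] using h)
        obtain ⟨h₁, h₂⟩ := Prod.ext_iff.1 hi
        simp only [vertexAt, List.get_eq_getElem] at h₁ h₂
        refine ⟨i.succ, ?_⟩
        simp [vertexAt, h₁, List.count_cons_of_ne hb] at h₂ ⊢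
        exact h₂

theorem AreAssociated.perm {d e : List ℕ} (h : AreAssociated d e) : d.Perm e := by
  obtain ⟨σ, hσ, -⟩ := h
  rw [← Multiset.coe_eq_coe, ← List.ofFn_get d, ← List.ofFn_get e, ← Fin.univ_val_map,
    ← Fin.univ_val_map, ← Multiset.map_univ_val_equiv σ, Multiset.map_map]
  exact Multiset.map_congr rfl fun i _ => hσ i

/-- Each member of `D` is a transitive Hamiltonian path of the relation graph. Of the association
relation only the equality of underlying multisets is needed. -/
theorem relationGraph_exists_path {n : ℕ} {D : Finset (List ℕ)} (hD : IsNormalized n D) :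
    (∃ e, (relationGraph D).IsTransitiveHamiltonianPath e) ∧ (relationGraph D).degree = n := by
  obtain ⟨d, hd⟩ := hD.nonempty
  have he : (relationGraph D).IsTransitiveHamiltonianPath (List.ofFn (vertexAt d)) :=
    { nodup := List.nodup_ofFn.2 (vertexAt_injective d)
      mem_iff := fun v => by
        simp only [relationGraph, Finset.mem_biUnion, Finset.mem_image, Finset.mem_univ, true_and,
          List.mem_ofFn', Set.mem_range, exists_vertexAt_eq_iff]
        refine ⟨fun h => ⟨d, hd, h⟩, fun ⟨d', hd', h⟩ => ?_⟩
        rwa [(hD.associated d hd d' hd').perm.count_eq]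
      transitive := List.pairwise_ofFn.2 fun i j hij => ⟨d, hd, i, j, hij, rfl, rfl⟩ }
  refine ⟨⟨_, he⟩, ?_⟩
  rw [he.degree_eq, List.map_ofFn, ← (hD.factorization d hd).1]
  exact congrArg List.prod (List.ofFn_get d)

end TameCollision

theorem theorem3p14 (F : Type*) [Field F] (n : ℕ) (hn : (n : F) ≠ 0)
    (D : Finset (List ℕ)) (hD : TameCollision.IsNormalized n D)
    (G : TameCollision.FactorGraph) (hG : G = TameCollision.relationGraph D) :
    (∃ Gs : List TameCollision.FactorGraph, G.IsComponentChain Gs) ∧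
    ∀ Gs : List TameCollision.FactorGraph, G.IsComponentChain Gs →
      TameCollision.collisions F G =
        TameCollision.compSets (Gs.map (TameCollision.collisions F)) ∧
      (∀ f ∈ TameCollision.collisions F G, ∃! gs : List (Polynomial F),
        List.Forall₂ (fun g H => g ∈ TameCollision.collisions F H) gs Gs ∧
          f = TameCollision.compList gs) ∧
      (Finite F →
        (TameCollision.collisions F G).Finite ∧
        (∀ H ∈ Gs, (TameCollision.collisions F H).Finite) ∧
        (TameCollision.collisions F G).ncard =
          (Gs.map fun H => (TameCollision.collisions F H).ncard).prod) := by
  open TameCollision in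
  obtain ⟨⟨e, he⟩, hdeg⟩ := relationGraph_exists_path hD
  rw [← hG] at he hdeg
  refine ⟨he.exists_isComponentChain, fun Gs hGs => ?_⟩
  rw [← hdeg] at hn
  have hprod := hGs.prod_degree he
  have heq : collisions F G = compSets (Gs.map (collisions F)) :=
    (collisions_subset_compSets hGs he hn).antisymm
      (compSets_collisions_subset hGs he fun h => hn (by rw [h, Nat.cast_zero]))
  refine ⟨heq, fun f hf => ?_, fun _ => ⟨?_, fun H _ => ?_, ?_⟩⟩
  · rw [heq] at hf
    obtain ⟨gs, hgs, rfl⟩ := mem_compSets_map.1 hf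
    refine ⟨gs, ⟨hgs, rfl⟩, fun gs' h => ?_⟩
    exact (eq_of_compList_eq (hprod ▸ hn) (forall₂_mem_monicOriginal_of_collisions hgs)
      (forall₂_mem_monicOriginal_of_collisions h.1) h.2).symm
  · exact (finite_monicOriginal G.degree).subset fun f hf => hf.1
  · exact (finite_monicOriginal H.degree).subset fun f hf => hf.1
  · rw [heq]
    exact ncard_compSets (deg := FactorGraph.degree) (fun H _ f hf => hf.1) (hprod ▸ hn)
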